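/- Let $d\ge 1$, $K\ge 2$, let $\Delta\subset\mathbb R^d$ be a bounded perturbation set, and let $\mathfrak r$ be a non-atomic Borel probability measure on $\Delta$ that is fully supported on $\Delta$ (every nonempty relatively open subset of $\Delta$ has positive measure). Instances are $x\in\mathbb R^d$, labels are $y\in\mathcal Y$ with $|\mathcal Y|=K$, and hypotheses are measurable maps $h:\mathbb R^d\to\mathcal Y$. For $\rho\in[0,1)$ the probabilistically robust 0-1 loss at level $\rho$ is the $\rho$-essential supremum $$g_\rho(h,x,y)=\inf\big\{u\in\mathbb R:\ \mathfrak r\{\delta\in\Delta:\ \mathbf 1[h(x+\delta)\ne y]>u\}\le\rho\big\}$$ (for $\rho=0$, the adversarial version, this is the essential supremum over $\delta\sim\mathfrak r$), and the nominal loss is $g_{\mathrm{nom}}(h,x,y)=\mathbf 1[h(x)\neq y]$. For a class $\mathcal H$, a loss $g$ and a probability distribution $\mathfrak D$ on $\mathbb R^d\times\mathcal Y$ put $$P^\star=\inf_{h\in\mathcal H}\mathbb E_{(x,y)\sim\mathfrak D}[g(h,x,y)],\qquad \hat P^\star=\inf_{h\in\mathcal H}\frac1N\sum_{n=1}^N g(h,x_n,y_n),$$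 with $(x_n,y_n)\sim\mathfrak D$ i.i.d. The sample complexity $N(\epsilon,\delta)$ of $(\mathcal H,g)$ is the least $N_0$ such that for all $N\ge N_0$ and all $\mathfrak D$ one has $|P^\star-\hat P^\star|\le\epsilon$ with probability at least $1-\delta$. There are universal constants $\epsilon_0,\delta_0,c>0$ and, for each $\delta$, a constant $C(\delta)$ depending only on $\delta$, such that for all $d,K,\Delta,\mathfrak r$ as above and every $\rho_o\in(0,1/2)$ there is a nonempty hypothesis class $\mathcal H_o$ for which, for all $0<\epsilon<\epsilon_0$ and $0<\delta<\delta_0$, the sample complexities are finite and: 1. for $g_0$ (i.e. $\rho=0$): $\;c\,\log_2(1/\rho_o)/\epsilon^2\le N(\epsilon,\delta)\le C(\delta)\,\log_2(1/\rho_o)/\epsilon^2$, i.e. $N=\Theta(\log_2(1/\rho_o)/\epsilon^2)$; 2. for $g_\rho$ with any $\rho_o\le\rho\le1-\rho_o$: $\;c/\epsilon^2\le N(\epsilon,\delta)\le C(\delta)/\epsilon^2$, i.e. $N=\Theta(1/\epsilon^2)$; 3. for the nominal loss $g_{\mathrm{nom}}$: likewise $c/\epsilon^2\le N(\epsilon,\delta)\le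 C(\delta)/\epsilon^2$, i.e. $N=\Theta(1/\epsilon^2)$. -/

import Mathlib

open MeasureTheory Set

/-- The 0-1 loss on a label set `Y`. -/
noncomputable def zeroOneLoss {Y : Type*} [DecidableEq Y] (y' y : Y) : ℝ :=
  if y' ≠ y then 1 else 0

/-- The `ρ`-essential supremum, for `ρ ∈ [0, 1)`, of a function `f` under a measure `p`: the
infimum of all levels `u` that `f` exceeds on a set of measure at most `ρ`. For `ρ = 0` this is
the essential supremum. -/
noncomputable def rhoEssSup {Ω : Type*} [MeasurableSpace Ω] (p : Measure Ω) (ρ : ℝ)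
    (f : Ω → ℝ) : ℝ :=
  sInf {u : ℝ | p {x | u < f x} ≤ ENNReal.ofReal ρ}

/-- The nominal loss of a hypothesis `h` at a labelled instance `z = (x, y)`. -/
noncomputable def nominalLoss {X Y : Type*} [DecidableEq Y] (h : X → Y) (z : X × Y) : ℝ :=
  zeroOneLoss (h z.1) z.2

/-- The probabilistically robust loss at level `ρ` of a hypothesis `h` at a labelled instance
`z = (x, y)`, for a perturbation measure `r` on the set `Δ` of allowed perturbations. -/
noncomputable def robustLoss {X Y : Type*} [Add X] [MeasurableSpace X] [DecidableEq Y]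
    {Δ : Set X} (r : Measure Δ) (ρ : ℝ) (h : X → Y) (z : X × Y) : ℝ :=
  rhoEssSup r ρ (fun δ : Δ => zeroOneLoss (h (z.1 + (δ : X))) z.2)

/-- The optimal value `P⋆ = inf_{h ∈ H} E_{z ∼ D} [g h z]` of the statistical problem with
objective `g` over the class `H`. -/
noncomputable def statOptValue {A Z : Type*} [MeasurableSpace Z] (g : A → Z → ℝ) (H : Set A)
    (D : Measure Z) : ℝ :=
  ⨅ h : H, ∫ z, g h z ∂D

/-- The optimal value `P̂⋆ = inf_{h ∈ H} (1/N) ∑ₙ g h zₙ` of the empirical problem for the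
sample `s = (z₁, …, z_N)`. -/
noncomputable def empOptValue {A Z : Type*} (g : A → Z → ℝ) (H : Set A) {N : ℕ}
    (s : Fin N → Z) : ℝ :=
  ⨅ h : H, (1 / (N : ℝ)) * ∑ n, g h (s n)

/-- `N` i.i.d. samples suffice for accuracy `ε` and confidence `1 - δ`: under every data
distribution `D`, the event `|P⋆ - P̂⋆| ≤ ε` fails with probability at most `δ`. -/
def SamplesSuffice {A Z : Type*} [MeasurableSpace Z] (g : A → Z → ℝ) (H : Set A)
    (ε δ : ℝ) (N : ℕ) : Prop :=
  ∀ D : Measure Z, IsProbabilityMeasure D →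
    Measure.pi (fun _ : Fin N => D) {s | ¬ |statOptValue g H D - empOptValue g H s| ≤ ε}
      ≤ ENNReal.ofReal δ

/-- `N` is the sample complexity, at accuracy `ε` and confidence `1 - δ`, of learning the class
`H` with objective `g`: the least `N` such that every sample size `≥ N` suffices. -/
def IsSampleComplexity {A Z : Type*} [MeasurableSpace Z] (g : A → Z → ℝ) (H : Set A)
    (ε δ : ℝ) (N : ℕ) : Prop :=
  IsLeast {N₀ : ℕ | ∀ n, N₀ ≤ n → SamplesSuffice g H ε δ n} N

/-! Let `m = ⌈log₂(1/ρ₀)⌉` and take one classifier `h b` for each `b : Fin m → Bool`. Place base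
points `x (i, j)`, `i : Fin m`, `j : Bool`, so far apart that their perturbation sets do not meet,
and near each of them tiny disjoint spots, one for each `b`. The classifier `h b` outputs 1 on the
spots tagged `b` near the points `(i, b i)`, and 0 elsewhere. Non-atomicity makes the spots as small
as desired and full support makes each of them visible to an adversary, so `m` is a free choice.

Perturbations of any instance hit the spots of `h b` with probability below `ρ₀`, so for `ρ₀ ≤ ρ ≤ 1
- ρ₀` all classifiers have the loss of the constant 0. Nominally, at most one classifier differs
from 0 at any given instance; the total variance of these differences is bounded, and Chebyshev's
inequality controls all `2 ^ m` of them at once. A fair label at an untouched instance gives the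
lower bound `1 / ε ^ 2`.

Adversarially, `h b` errs at `(x (i, j), 0)` exactly when `b i = j`. Hoeffding's inequality and a
union bound over `2 ^ m` classifiers give order `m / ε ^ 2`. Conversely, under the uniform law on
these `2 m` points every classifier has risk 1/2, while the empirical minimiser errs on the rarer
member of each pair and gains `∑ |X i| / (2 N)`, where `X i` is the imbalance of pair `i`. Second
and fourth moments show that this gain is of order `√(m / N)` with probability at least 1/16. -/

/-! ### Geometry: small separated spots. -/

/-- A finite measure on a bounded set that charges no point gives uniformly small mass to small
balls. -/
theorem exists_forall_measure_ball_lt {E : Type*} [NormedAddCommGroup E] [ProperSpace E]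
    [MeasurableSpace E] [BorelSpace E] {Δ : Set E} (hΔ : Bornology.IsBounded Δ)
    (r : Measure Δ) [IsFiniteMeasure r] [NullSingletonClass r] {t : ENNReal} (ht : 0 < t) :
    ∃ η : ℝ, 0 < η ∧ ∀ x : E, r {δ : Δ | (δ : E) ∈ Metric.ball x η} < t := by
  set μ : Measure E := r.map Subtype.val with hμ
  have hball : ∀ x η, r {δ : Δ | (δ : E) ∈ Metric.ball x η} = μ (Metric.ball x η) := by
    intro x η
    rw [hμ, Measure.map_apply measurable_subtype_coe Metric.isOpen_ball.measurableSet]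
    rfl
  have hpt : ∀ x : E, μ {x} = 0 := by
    intro x
    rw [hμ, Measure.map_apply measurable_subtype_coe (measurableSet_singleton x)]
    refine Set.Subsingleton.measure_zero ?_ r
    intro a ha b hb
    exact Subtype.ext (ha.trans hb.symm)
  -- Outer regularity at a null point; the Lebesgue number of this cover of the compact closure
  -- makes the radius uniform.
  have hU : ∀ x : E, ∃ U, {x} ⊆ U ∧ IsOpen U ∧ μ U < t := fun x =>
    Set.exists_isOpen_lt_of_lt {x} t (by rw [hpt]; exact ht)
  choose U hxU hUo hUt using hU
  obtain ⟨η, hη, h⟩ := lebesgue_number_lemma_of_metric (s := closure Δ) hΔ.isCompact_closure hUo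
    (fun x _ => mem_iUnion.2 ⟨x, hxU x rfl⟩)
  -- Half the Lebesgue number, because the centre may lie off `Δ`: a ball meeting `Δ` is enclosed in
  -- one of twice the radius centred in `Δ`.
  refine ⟨η / 2, by positivity, fun x => ?_⟩
  by_cases hne : ∃ y ∈ Δ, y ∈ Metric.ball x (η / 2)
  · obtain ⟨y, hy, hyx⟩ := hne
    obtain ⟨i, hi⟩ := h y (subset_closure hy)
    rw [hball]
    refine lt_of_le_of_lt (measure_mono ?_) (hUt i)
    refine Subset.trans ?_ hi
    refine Metric.ball_subset_ball' ?_
    rw [Metric.mem_ball, dist_comm] at hyx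
    linarith
  · have : {δ : Δ | (δ : E) ∈ Metric.ball x (η / 2)} = ∅ := by
      ext δ
      simp only [mem_ofPred_eq, mem_empty_iff_false, iff_false]
      exact fun hδ => hne ⟨δ, δ.2, hδ⟩
    rw [this, measure_empty]
    exact ht

/-- Finitely many distinct points have a common radius at which the balls around them are
pairwise disjoint. -/
theorem exists_disjoint_balls {E ι : Type*} [MetricSpace E] [Finite ι] {c : ι → E}
    (hc : Function.Injective c) :
    ∃ η : ℝ, 0 < η ∧ ∀ i j, i ≠ j → ∀ z, z ∈ Metric.ball (c i) η → z ∉ Metric.ball (c j) η := by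
  obtain ⟨η, hη, h⟩ : ∃ η : ℝ, 0 < η ∧ ∀ p : ι × ι, p.1 ≠ p.2 → 2 * η ≤ dist (c p.1) (c p.2) := by
    have : ∀ p : ι × ι, ∀ᶠ η : ℝ in nhdsWithin 0 (Ioi 0),
        p.1 ≠ p.2 → 2 * η ≤ dist (c p.1) (c p.2) := by
      intro p
      by_cases hp : p.1 = p.2
      · simp [hp]
      · have hpos : 0 < dist (c p.1) (c p.2) := dist_pos.2 (fun h => hp (hc h))
        filter_upwards [Ioo_mem_nhdsGT (half_pos hpos)] with η hη _
        linarith [hη.2]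
    obtain ⟨η, h1, h2⟩ := ((Filter.eventually_all.2 this).and self_mem_nhdsWithin).exists
    exact ⟨η, h2, h1⟩
  refine ⟨η, hη, fun i j hij z hi hj => ?_⟩
  have h1 := h (i, j) hij
  rw [Metric.mem_ball] at hi hj
  have := dist_triangle_left (c i) (c j) z
  simp only at h1
  linarith

theorem infinite_of_nullSingletonClass {Ω : Type*} [MeasurableSpace Ω] (r : Measure Ω)
    [IsProbabilityMeasure r] [NullSingletonClass r] : Infinite Ω := by
  by_contra h
  rw [not_infinite_iff_finite] at h
  have := (Set.finite_univ (α := Ω)).measure_zero r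
  simp at this

/-- A finite family of well-separated base points together with small pairwise disjoint spots
near each of them: every spot is hit with positive probability by a perturbation of its base
point, never by a perturbation of another base point, and with probability less than `t` by the
perturbation of any point. -/
theorem exists_separated_spots {E : Type*} [NormedAddCommGroup E] [NormedSpace ℝ E]
    [ProperSpace E] [MeasurableSpace E] [BorelSpace E] {Δ : Set E} (hΔ : Bornology.IsBounded Δ)
    (r : Measure Δ) [IsProbabilityMeasure r] [NullSingletonClass r] [r.IsOpenPosMeasure]
    (P B : Type) [Finite P] [Finite B] {t : ENNReal} (ht : 0 < t) :
    ∃ (x : P → E) (S : P → B → Set E), Function.Injective x ∧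
      (∀ p b, MeasurableSet (S p b)) ∧
      (∀ p b q b', (p, b) ≠ (q, b') → ∀ z, z ∈ S p b → z ∉ S q b') ∧
      (∀ p b, 0 < r {δ : Δ | x p + (δ : E) ∈ S p b}) ∧
      (∀ p q b, p ≠ q → ∀ δ ∈ Δ, x p + δ ∉ S q b) ∧
      (∀ z p b, r {δ : Δ | z + (δ : E) ∈ S p b} < t) := by
  have hinf : Infinite Δ := infinite_of_nullSingletonClass r
  -- Excludes dimension 0 and provides a unit vector.
  have hnt : Nontrivial E := (Subtype.val_injective (p := (· ∈ Δ))).nontrivial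
  obtain ⟨M, hM0, hM⟩ := hΔ.exists_pos_norm_le
  obtain ⟨e, he⟩ := exists_norm_eq E (zero_le_one' ℝ)
  obtain ⟨n, ⟨eP⟩⟩ := Finite.exists_equiv_fin P
  obtain ⟨k, ⟨eB⟩⟩ := Finite.exists_equiv_fin B
  set a : B → Δ := fun b => Infinite.natEmbedding Δ (eB b) with ha
  have hainj : Function.Injective a := by
    intro b b' h
    exact eB.injective (Fin.ext ((Infinite.natEmbedding Δ).injective h))
  -- Base points on a line with spacing `2 * M + 1`, where `M` bounds `Δ`, so that translates of `Δ`
  -- stay at distance at least 1.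
  set x : P → E := fun p => (((eP p : ℕ) : ℝ) * (2 * M + 1)) • e with hx
  have hsep : ∀ p q, p ≠ q → 2 * M + 1 ≤ ‖x p - x q‖ := by
    intro p q hpq
    have h1 : ((eP p : ℕ) : ℤ) - ((eP q : ℕ) : ℤ) ≠ 0 := by
      intro h
      exact hpq (eP.injective (Fin.ext (by omega)))
    have h2 : (1 : ℝ) ≤ |((eP p : ℕ) : ℝ) - ((eP q : ℕ) : ℝ)| := by
      exact_mod_cast Int.one_le_abs h1
    rw [hx, ← sub_smul, norm_smul, he, mul_one, ← sub_mul, norm_mul, Real.norm_eq_abs,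
      Real.norm_of_nonneg (by positivity : (0:ℝ) ≤ 2 * M + 1)]
    nlinarith
  have hfar : ∀ p q, p ≠ q → ∀ δ ∈ Δ, ∀ δ' ∈ Δ, 1 ≤ dist (x p + δ) (x q + δ') := by
    intro p q hpq δ hδ δ' hδ'
    have h1 := hsep p q hpq
    have h2 : ‖x p - x q‖ ≤ ‖(x p + δ) - (x q + δ')‖ + ‖δ‖ + ‖δ'‖ := by
      have : x p - x q = ((x p + δ) - (x q + δ')) - δ + δ' := by abel
      calc ‖x p - x q‖ = ‖((x p + δ) - (x q + δ')) - δ + δ'‖ := by rw [← this]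
        _ ≤ ‖((x p + δ) - (x q + δ')) - δ‖ + ‖δ'‖ := norm_add_le _ _
        _ ≤ _ := by gcongr; exact norm_sub_le _ _
    rw [dist_eq_norm]
    linarith [hM δ hδ, hM δ' hδ']
  have hcinj : Function.Injective (fun pb : P × B => x pb.1 + (a pb.2 : E)) := by
    rintro ⟨p, b⟩ ⟨q, b'⟩ h
    simp only at h
    by_cases hpq : p = q
    · subst hpq
      rw [hainj (Subtype.ext (add_left_cancel h))]
    · have := hfar p q hpq _ (a b).2 _ (a b').2
      rw [h, dist_self] at this
      linarith
  obtain ⟨η₁, hη₁, hdisj⟩ := exists_disjoint_balls hcinj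
  obtain ⟨η₂, hη₂, hsmall⟩ := exists_forall_measure_ball_lt hΔ r ht
  -- The three bounds serve separation between base points, disjointness, and small mass.
  set η := min 1 (min η₁ η₂) with hη
  have hηpos : 0 < η := by positivity
  have hle1 : η ≤ 1 := min_le_left _ _
  have hle2 : η ≤ η₁ := (min_le_right _ _).trans (min_le_left _ _)
  have hle3 : η ≤ η₂ := (min_le_right _ _).trans (min_le_right _ _)
  refine ⟨x, fun p b => Metric.ball (x p + a b) η, ?_, fun p b => Metric.isOpen_ball.measurableSet,
    ?_, ?_, ?_, ?_⟩
  · intro p q h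
    by_contra hpq
    have := hsep p q hpq
    rw [h, sub_self, norm_zero] at this
    linarith
  · intro p b q b' hne z hz hz'
    exact hdisj (p, b) (q, b') hne z (Metric.ball_subset_ball hle2 hz)
      (Metric.ball_subset_ball hle2 hz')
  · intro p b
    refine IsOpen.measure_pos r ?_ ⟨a b, ?_⟩
    · exact Metric.isOpen_ball.preimage (continuous_const.add continuous_subtype_val)
    · exact Metric.mem_ball_self hηpos
  · intro p q b hpq δ hδ hmem
    have := hfar p q hpq δ hδ _ (a b).2
    rw [Metric.mem_ball] at hmem
    linarith
  · intro z p b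
    refine lt_of_le_of_lt (measure_mono ?_) (hsmall (x p + a b - z))
    intro δ hδ
    simp only [mem_ofPred_eq, Metric.mem_ball, dist_eq_norm] at hδ ⊢
    rw [show (δ : E) - (x p + a b - z) = z + δ - (x p + a b) by abel]
    linarith

/-! ### Moments and anti-concentration of i.i.d. sums. -/

section Moments

variable {Z : Type*} [MeasurableSpace Z] (D : Measure Z) [IsProbabilityMeasure D]

theorem measurable_sum_eval {f : Z → ℝ} (hf : Measurable f) (N : ℕ) :
    Measurable (fun s : Fin N → Z => ∑ n, f (s n)) :=
  Finset.measurable_sum _ fun n _ => hf.comp (measurable_pi_apply n)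

theorem integrable_sum_eval_pow {f : Z → ℝ} (hf : Measurable f) {M : ℝ} (hM : ∀ z, |f z| ≤ M)
    (N k : ℕ) :
    Integrable (fun s : Fin N → Z => (∑ n, f (s n)) ^ k) (Measure.pi fun _ : Fin N => D) := by
  refine Integrable.of_bound ((measurable_sum_eval hf N).pow_const k).aestronglyMeasurable
    ((N * M) ^ k) (Filter.Eventually.of_forall fun s => ?_)
  rw [norm_pow, Real.norm_eq_abs]
  refine pow_le_pow_left₀ (abs_nonneg _) ?_ k
  calc |∑ n, f (s n)| ≤ ∑ n, |f (s n)| := Finset.abs_sum_le_sum_abs _ _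
    _ ≤ ∑ _n : Fin N, M := Finset.sum_le_sum fun n _ => hM _
    _ = N * M := by simp

theorem integrable_bounded_pow {f : Z → ℝ} (hf : Measurable f) {M : ℝ} (hM : ∀ z, |f z| ≤ M)
    (k : ℕ) : Integrable (fun z => f z ^ k) D := by
  refine Integrable.of_bound (hf.pow_const k).aestronglyMeasurable (M ^ k)
    (Filter.Eventually.of_forall fun s => ?_)
  rw [norm_pow, Real.norm_eq_abs]
  exact pow_le_pow_left₀ (abs_nonneg _) (hM _) k

theorem integral_sum_eval_succ_pow (f : Z → ℝ) (N k : ℕ) :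
    ∫ s : Fin (N + 1) → Z, (∑ n, f (s n)) ^ k ∂(Measure.pi fun _ => D) =
      ∫ p : Z × (Fin N → Z), (f p.1 + ∑ n, f (p.2 n)) ^ k ∂(D.prod (Measure.pi fun _ => D)) := by
  have h := measurePreserving_piFinSuccAbove (fun _ : Fin (N + 1) => D) 0
  rw [← h.integral_comp (MeasurableEquiv.measurableEmbedding _)]
  refine integral_congr_ae (Filter.Eventually.of_forall fun s => ?_)
  simp only [Fin.sum_univ_succ]
  rfl

/-- The moments of a sum of `N + 1` i.i.d. variables in terms of those of a sum of `N`. -/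
theorem integral_sum_eval_succ_pow_eq {f : Z → ℝ} (hf : Measurable f) {M : ℝ}
    (hM : ∀ z, |f z| ≤ M) (N k : ℕ) :
    ∫ s : Fin (N + 1) → Z, (∑ n, f (s n)) ^ k ∂(Measure.pi fun _ => D) =
      ∑ j ∈ Finset.range (k + 1), (∫ z, f z ^ j ∂D) *
        (∫ s : Fin N → Z, (∑ n, f (s n)) ^ (k - j) ∂(Measure.pi fun _ => D)) * k.choose j := by
  rw [integral_sum_eval_succ_pow]
  simp_rw [add_pow]
  rw [integral_finsetSum]
  · refine Finset.sum_congr rfl fun j _ => ?_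
    rw [integral_mul_const]
    congr 1
    exact integral_prod_mul (fun z => f z ^ j) (fun s : Fin N → Z => (∑ n, f (s n)) ^ (k - j))
  · exact fun j _ => ((integrable_bounded_pow D hf hM j).mul_prod
      (integrable_sum_eval_pow D hf hM N (k - j))).mul_const _

/-- The second moment of a sum of i.i.d. centred variables. -/
theorem integral_sum_eval_sq {f : Z → ℝ} (hf : Measurable f) {M : ℝ} (hM : ∀ z, |f z| ≤ M)
    (h1 : ∫ z, f z ∂D = 0) (N : ℕ) :
    ∫ s : Fin N → Z, (∑ n, f (s n)) ^ 2 ∂(Measure.pi fun _ => D) = N * ∫ z, f z ^ 2 ∂D := by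
  induction N with
  | zero => simp
  | succ N ih =>
    rw [integral_sum_eval_succ_pow_eq D hf hM]
    simp [Finset.sum_range_succ, h1, ih]
    ring

/-- The fourth moment of a sum of i.i.d. variables with vanishing first and third moment. -/
theorem integral_sum_eval_pow_four {f : Z → ℝ} (hf : Measurable f) {M : ℝ} (hM : ∀ z, |f z| ≤ M)
    (h1 : ∫ z, f z ∂D = 0) (h3 : ∫ z, f z ^ 3 ∂D = 0) (N : ℕ) :
    ∫ s : Fin N → Z, (∑ n, f (s n)) ^ 4 ∂(Measure.pi fun _ => D) =
      N * ∫ z, f z ^ 4 ∂D + 3 * N * (N - 1) * (∫ z, f z ^ 2 ∂D) ^ 2 := by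
  induction N with
  | zero => simp
  | succ N ih =>
    have h2 := integral_sum_eval_sq D hf hM h1 N
    rw [integral_sum_eval_succ_pow_eq D hf hM]
    simp [Finset.sum_range_succ, h1, h2, h3, ih, show Nat.choose 4 2 = 6 from rfl]
    ring

/-- Anti-concentration: for `N ≥ m`, a sum of the absolute values of `m` i.i.d. sums, each with
second and fourth moments `1 / m` per term, exceeds a fixed multiple of `√(m N)` with probability
bounded from below. -/
theorem le_measure_sum_abs_sum_eval {ι : Type*} [Fintype ι] [Nonempty ι] {f : ι → Z → ℝ}
    (hf : ∀ i, Measurable (f i)) (hM : ∀ i z, |f i z| ≤ 1)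
    (h1 : ∀ i, ∫ z, f i z ∂D = 0) (h2 : ∀ i, ∫ z, f i z ^ 2 ∂D = 1 / Fintype.card ι)
    (h3 : ∀ i, ∫ z, f i z ^ 3 ∂D = 0) (h4 : ∀ i, ∫ z, f i z ^ 4 ∂D = 1 / Fintype.card ι)
    {N : ℕ} (hN : Fintype.card ι ≤ N) :
    1 / 16 ≤ (Measure.pi fun _ : Fin N => D).real
      {s | √(Fintype.card ι * N) / 4 < ∑ i, |∑ n, f i (s n)|} := by
  set m : ℝ := ((Fintype.card ι : ℕ) : ℝ) with hm
  have hmpos : 0 < m := by rw [hm]; exact_mod_cast Fintype.card_pos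
  have hmN : m ≤ N := by rw [hm]; exact_mod_cast hN
  have hNpos : (0 : ℝ) < N := hmpos.trans_le hmN
  set μ := Measure.pi fun _ : Fin N => D with hμ
  set S : ι → (Fin N → Z) → ℝ := fun i s => ∑ n, f i (s n) with hS
  set T : (Fin N → Z) → ℝ := fun s => ∑ i, |S i s| with hT
  have hSm : ∀ i, Measurable (S i) := fun i => measurable_sum_eval (hf i) N
  have hSI : ∀ i k, Integrable (fun s => S i s ^ k) μ := fun i k =>
    integrable_sum_eval_pow D (hf i) (hM i) N k
  -- The standard deviation of each `S i`. As `N ≥ m` gives `l ≥ 1`, the fourth moment is at most `l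
  -- ^ 2 + 3 * l ^ 4 ≤ 4 * l ^ 4`.
  set l : ℝ := √(N / m) with hl
  have hlpos : 0 < l := Real.sqrt_pos.2 (by positivity)
  have hl2 : l ^ 2 = N / m := Real.sq_sqrt (by positivity)
  have hl1 : 1 ≤ l ^ 2 := by rw [hl2, le_div_iff₀ hmpos]; linarith
  have hS2 : ∀ i, ∫ s, S i s ^ 2 ∂μ = l ^ 2 := fun i => by
    rw [hl2, integral_sum_eval_sq D (hf i) (hM i) (h1 i), h2 i]; ring
  have hS4 : ∀ i, ∫ s, S i s ^ 4 ∂μ ≤ 4 * l ^ 4 := fun i => by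
    rw [integral_sum_eval_pow_four D (hf i) (hM i) (h1 i) (h3 i), h2 i, h4 i]
    have e1 : (N : ℝ) * (1 / m) = l ^ 2 := by rw [hl2]; ring
    have e2 : 3 * (N : ℝ) * (N - 1) * (1 / m) ^ 2 ≤ 3 * l ^ 4 := by
      have : 3 * l ^ 4 = 3 * (N : ℝ) * N * (1 / m) ^ 2 := by
        rw [show l ^ 4 = (l ^ 2) ^ 2 by ring, hl2]; ring
      rw [this]
      gcongr
      linarith
    rw [e1]
    nlinarith
  have hSabs : ∀ i, Integrable (fun s => |S i s|) μ := fun i => by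
    simpa using (hSI i 1).abs
  have hE : ∀ i, l / 2 ≤ ∫ s, |S i s| ∂μ := fun i => by
    -- An even quartic minorant of the absolute value, tangent to it at `|S i s| = 2 * l`; it turns
    -- the two moment bounds into a lower bound for the first absolute moment.
    have hpt : ∀ s, 3 / (4 * l) * S i s ^ 2 - 1 / (16 * l ^ 3) * S i s ^ 4 ≤ |S i s| := by
      intro s
      set t := |S i s| / (2 * l) with ht
      have ht0 : 0 ≤ t := by positivity
      have hSt : |S i s| = 2 * l * t := by rw [ht]; field_simp
      have ha2 : S i s ^ 2 = (2 * l * t) ^ 2 := by rw [← hSt, sq_abs]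
      have ha4 : S i s ^ 4 = (2 * l * t) ^ 4 := by
        rw [show S i s ^ 4 = (S i s ^ 2) ^ 2 by ring, ha2]; ring
      rw [ha2, ha4, hSt]
      have e : 2 * l * t - (3 / (4 * l) * (2 * l * t) ^ 2 - 1 / (16 * l ^ 3) * (2 * l * t) ^ 4)
          = l * (t * (t - 1) ^ 2 * (t + 2)) := by field_simp; ring
      have : 0 ≤ l * (t * (t - 1) ^ 2 * (t + 2)) := by positivity
      linarith
    have hi := integral_mono (((hSI i 2).const_mul _).sub ((hSI i 4).const_mul _)) (hSabs i) hpt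
    rw [integral_sub' ((hSI i 2).const_mul _) ((hSI i 4).const_mul _), integral_const_mul,
      integral_const_mul, hS2] at hi
    have : 1 / (16 * l ^ 3) * ∫ s, S i s ^ 4 ∂μ ≤ 1 / (16 * l ^ 3) * (4 * l ^ 4) :=
      mul_le_mul_of_nonneg_left (hS4 i) (by positivity)
    have e : 3 / (4 * l) * l ^ 2 - 1 / (16 * l ^ 3) * (4 * l ^ 4) = l / 2 := by field_simp; ring
    linarith
  set q : ℝ := √(m * N) with hq
  have hqpos : 0 < q := Real.sqrt_pos.2 (by positivity)
  have hqml : q = m * l := by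
    rw [hq, hl, Real.sqrt_eq_iff_mul_self_eq_of_pos (by positivity)]
    rw [mul_mul_mul_comm, Real.mul_self_sqrt (by positivity)]
    field_simp
  have hET : q / 2 ≤ ∫ s, T s ∂μ := by
    rw [hT, integral_finsetSum _ (fun i _ => hSabs i)]
    calc q / 2 = ∑ _i : ι, l / 2 := by simp [hqml, hm]; ring
      _ ≤ _ := Finset.sum_le_sum fun i _ => hE i
  have hpt : ∀ s, T s ^ 2 ≤ m * ∑ i, S i s ^ 2 := fun s => by
    have := sq_sum_le_card_mul_sum_sq (s := Finset.univ) (f := fun i => |S i s|)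
    simpa [hT, hm] using this
  have hTm : Measurable T := Finset.measurable_sum _ fun i _ => (hSm i).abs
  have hsumI : Integrable (fun s => ∑ i, S i s ^ 2) μ := integrable_finsetSum _ fun i _ => hSI i 2
  have hT2I : Integrable (fun s => T s ^ 2) μ := by
    refine (hsumI.const_mul m).mono' (hTm.pow_const 2).aestronglyMeasurable
      (Filter.Eventually.of_forall fun s => ?_)
    rw [Real.norm_of_nonneg (sq_nonneg _)]
    exact hpt s
  have hET2 : ∫ s, T s ^ 2 ∂μ ≤ q ^ 2 := by
    calc ∫ s, T s ^ 2 ∂μ ≤ ∫ s, m * ∑ i, S i s ^ 2 ∂μ :=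
          integral_mono hT2I (hsumI.const_mul m) hpt
      _ = q ^ 2 := by
          rw [integral_const_mul, integral_finsetSum _ fun i _ => hSI i 2]
          simp [hS2, hqml, ← hm]; ring
  set A : Set (Fin N → Z) := {s | q / 4 < T s} with hA
  have hAm : MeasurableSet A := measurableSet_lt measurable_const hTm
  have hTI : Integrable T μ := integrable_finsetSum _ fun i _ => hSabs i
  have hAI : Integrable (A.indicator (1 : (Fin N → Z) → ℝ)) μ :=
    (integrable_const (1 : ℝ)).indicator hAm
  -- A Paley–Zygmund argument with AM-GM for Cauchy–Schwarz. Taking expectations, `q / 2 ≤ q / 4 + q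
  -- / 8 + 2 * q * P(A)`, whence `P(A) ≥ 1 / 16`.
  have hkey : ∀ s, T s ≤ q / 4 + (1 / (8 * q) * T s ^ 2 + 2 * q * A.indicator 1 s) := by
    intro s
    by_cases hs : s ∈ A
    · rw [indicator_of_mem hs, Pi.one_apply]
      have e : 1 / (8 * q) * T s ^ 2 + 2 * q * 1 - T s = (T s - 4 * q) ^ 2 / (8 * q) := by
        field_simp; ring
      have : 0 ≤ (T s - 4 * q) ^ 2 / (8 * q) := by positivity
      linarith
    · rw [indicator_of_notMem hs]
      have h : T s ≤ q / 4 := not_lt.1 hs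
      have : 0 ≤ 1 / (8 * q) * T s ^ 2 := by positivity
      linarith
  have hi := integral_mono hTI ((integrable_const (q / 4)).add
    ((hT2I.const_mul (1 / (8 * q))).add (hAI.const_mul (2 * q)))) hkey
  rw [integral_add' (integrable_const (q / 4))
    ((hT2I.const_mul (1 / (8 * q))).add (hAI.const_mul (2 * q))),
    integral_add' (hT2I.const_mul (1 / (8 * q))) (hAI.const_mul (2 * q)),
    integral_const_mul, integral_const_mul, integral_indicator_one hAm] at hi
  simp only [integral_const, probReal_univ, one_smul] at hi
  have h5 : 1 / (8 * q) * ∫ s, T s ^ 2 ∂μ ≤ 1 / (8 * q) * q ^ 2 :=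
    mul_le_mul_of_nonneg_left hET2 (by positivity)
  have h6 : 1 / (8 * q) * q ^ 2 = q / 8 := by field_simp
  have h7 : q / 8 ≤ 2 * q * μ.real A := by linarith
  change 1 / 16 ≤ μ.real A
  have h8 : q * (1 / 16) ≤ q * μ.real A := by linarith
  exact le_of_mul_le_mul_left h8 hqpos

end Moments

/-! ### Sufficient sample sizes. -/

section UpperBounds

theorem abs_iInf_sub_iInf_le {ι : Type*} [Nonempty ι] {a b : ι → ℝ} {ε : ℝ}
    (ha : ∀ i, 0 ≤ a i) (hb : ∀ i, 0 ≤ b i) (h : ∀ i, |a i - b i| ≤ ε) :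
    |(⨅ i, a i) - ⨅ i, b i| ≤ ε := by
  have ha' : BddBelow (range a) := ⟨0, by rintro _ ⟨i, rfl⟩; exact ha i⟩
  have hb' : BddBelow (range b) := ⟨0, by rintro _ ⟨i, rfl⟩; exact hb i⟩
  rw [abs_le]
  constructor
  · have : (⨅ i, b i) - ε ≤ ⨅ i, a i := le_ciInf fun i => by
      linarith [ciInf_le hb' i, (abs_le.1 (h i)).1]
    linarith
  · have : (⨅ i, a i) - ε ≤ ⨅ i, b i := le_ciInf fun i => by
      linarith [ciInf_le ha' i, (abs_le.1 (h i)).2]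
    linarith

variable {A Z : Type*} [MeasurableSpace Z]

/-- Uniform deviations over the class control the deviation of the optimal values. -/
theorem exists_deviation_of_not_abs_sub_le {B : Type*} [Nonempty B] {g : A → Z → ℝ} {h : B → A}
    (hg : ∀ b z, 0 ≤ g (h b) z) {D : Measure Z} {ε : ℝ} {N : ℕ} {s : Fin N → Z}
    (hs : ¬ |statOptValue g (range h) D - empOptValue g (range h) s| ≤ ε) :
    ∃ b, ε < |(∫ z, g (h b) z ∂D) - (1 / (N : ℝ)) * ∑ n, g (h b) (s n)| := by
  by_contra! hcon
  refine hs (abs_iInf_sub_iInf_le ?_ ?_ ?_)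
  · rintro ⟨_, b, rfl⟩
    exact integral_nonneg (hg b)
  · rintro ⟨_, b, rfl⟩
    exact mul_nonneg (by positivity) (Finset.sum_nonneg fun n _ => hg b _)
  · rintro ⟨_, b, rfl⟩
    exact hcon b

variable (D : Measure Z) [IsProbabilityMeasure D]

open ProbabilityTheory in
-- By Hoeffding's lemma a `[0, 1]`-valued variable is sub-Gaussian with variance proxy 1/4; the
-- Chernoff bound for the independent sum does the rest.
theorem measure_hoeffding_one_sided {G : Z → ℝ} (hG : Measurable G) (h0 : ∀ z, 0 ≤ G z)
    (h1 : ∀ z, G z ≤ 1) {N : ℕ} (hN : 0 < N) {ε : ℝ} (hε : 0 ≤ ε) :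
    (Measure.pi fun _ : Fin N => D).real {s | N * ε ≤ ∑ n, (G (s n) - ∫ z, G z ∂D)}
      ≤ Real.exp (-(2 * N * ε ^ 2)) := by
  set μ := Measure.pi fun _ : Fin N => D with hμ
  have hint : ∀ n : Fin N, ∫ s, G (s n) ∂μ = ∫ z, G z ∂D := fun n =>
    integral_comp_eval (μ := fun _ : Fin N => D) hG.aestronglyMeasurable
  have hind : iIndepFun (fun (n : Fin N) (s : Fin N → Z) => G (s n) - ∫ z, G z ∂D) μ :=
    iIndepFun_pi (X := fun _ z => G z - ∫ z, G z ∂D) fun _ => (hG.sub_const _).aemeasurable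
  have hsub : ∀ n ∈ (Finset.univ : Finset (Fin N)),
      HasSubgaussianMGF (fun s : Fin N → Z => G (s n) - ∫ z, G z ∂D)
        ((‖(1 : ℝ) - 0‖₊ / 2) ^ 2) μ := fun n _ => by
    have := hasSubgaussianMGF_of_mem_Icc (μ := μ) (X := fun s => G (s n)) (a := 0) (b := 1)
      (hG.comp (measurable_pi_apply n)).aemeasurable
      (Filter.Eventually.of_forall fun s => ⟨h0 _, h1 _⟩)
    rwa [hint n] at this
  have hNR : (0 : ℝ) < N := by exact_mod_cast hN
  have := HasSubgaussianMGF.measure_sum_ge_le_of_iIndepFun hind hsub (ε := N * ε) (by positivity)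
  refine this.trans (le_of_eq ?_)
  congr 1
  simp
  field_simp

/-- Hoeffding's inequality for the empirical mean of a `[0, 1]`-valued function. -/
theorem measure_hoeffding {G : Z → ℝ} (hG : Measurable G) (h0 : ∀ z, 0 ≤ G z)
    (h1 : ∀ z, G z ≤ 1) {N : ℕ} (hN : 0 < N) {ε : ℝ} (hε : 0 ≤ ε) :
    (Measure.pi fun _ : Fin N => D).real
      {s | ε < |(∫ z, G z ∂D) - (1 / (N : ℝ)) * ∑ n, G (s n)|}
      ≤ 2 * Real.exp (-(2 * N * ε ^ 2)) := by
  have hNR : (0 : ℝ) < N := by exact_mod_cast hN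
  have hI : Integrable G D := Integrable.of_mem_Icc 0 1 hG.aemeasurable
    (Filter.Eventually.of_forall fun z => ⟨h0 z, h1 z⟩)
  have hp := measure_hoeffding_one_sided D hG h0 h1 hN hε
  have hn := measure_hoeffding_one_sided D (G := fun z => 1 - G z) (measurable_const.sub hG)
    (fun z => by linarith [h1 z]) (fun z => by linarith [h0 z]) hN hε
  rw [two_mul]
  refine le_trans (measureReal_mono ?_) ((measureReal_union_le _ _).trans (add_le_add hp hn))
  intro s hs
  simp only [mem_ofPred_eq, mem_union] at hs ⊢
  have e1 : ∑ n, (G (s n) - ∫ z, G z ∂D) = (∑ n, G (s n)) - N * ∫ z, G z ∂D := by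
    simp [Finset.sum_sub_distrib]
  have e2 : ∑ n, ((1 - G (s n)) - ∫ z, (1 - G z) ∂D) = -((∑ n, G (s n)) - N * ∫ z, G z ∂D) := by
    rw [integral_sub (integrable_const _) hI]
    simp [Finset.sum_sub_distrib]
  have e3 : ∑ n, G (s n) = N * ((1 / (N : ℝ)) * ∑ n, G (s n)) := by field_simp
  rw [e1, e2, e3]
  rcases lt_abs.1 hs with h | h
  · right; nlinarith
  · left; nlinarith

/-- A finite class of `[0, 1]`-valued losses: Hoeffding's inequality and a union bound. -/
theorem samplesSuffice_of_hoeffding {B : Type*} [Fintype B] [Nonempty B] {g : A → Z → ℝ}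
    {h : B → A} (hm : ∀ b, Measurable (g (h b))) (h0 : ∀ b z, 0 ≤ g (h b) z)
    (h1 : ∀ b z, g (h b) z ≤ 1) {ε δ : ℝ} (hε : 0 ≤ ε) {N : ℕ} (hN : 0 < N)
    (hNδ : Fintype.card B * (2 * Real.exp (-(2 * N * ε ^ 2))) ≤ δ) :
    SamplesSuffice g (range h) ε δ N := by
  intro D hD
  rw [← ofReal_measureReal]
  refine ENNReal.ofReal_le_ofReal (le_trans ?_ hNδ)
  have hsub : {s : Fin N → Z | ¬ |statOptValue g (range h) D - empOptValue g (range h) s| ≤ ε} ⊆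
      ⋃ b, {s | ε < |(∫ z, g (h b) z ∂D) - (1 / (N : ℝ)) * ∑ n, g (h b) (s n)|} := by
    intro s hs
    exact mem_iUnion.2 (exists_deviation_of_not_abs_sub_le h0 hs)
  refine (measureReal_mono hsub).trans ((measureReal_iUnion_fintype_le _).trans ?_)
  refine (Finset.sum_le_sum fun b _ => measure_hoeffding D (hm b) (h0 b) (h1 b) hN hε).trans ?_
  simp

/-- Variance is at most the raw second moment, and raw second moments can be summed pointwise over a
family of losses. -/
theorem integral_sum_eval_sub_sq_le {u : Z → ℝ} (hu : Measurable u) (hM : ∀ z, |u z| ≤ 1)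
    (N : ℕ) :
    Integrable (fun s : Fin N → Z => (∑ n, (u (s n) - ∫ z, u z ∂D)) ^ 2)
      (Measure.pi fun _ => D) ∧
    ∫ s : Fin N → Z, (∑ n, (u (s n) - ∫ z, u z ∂D)) ^ 2 ∂(Measure.pi fun _ => D)
      ≤ N * ∫ z, u z ^ 2 ∂D := by
  have hI : Integrable u D := by simpa using integrable_bounded_pow D hu hM 1
  have hI2 := integrable_bounded_pow D hu hM 2
  set a := ∫ z, u z ∂D with ha
  have hb : ∀ z, |u z - a| ≤ 1 + |a| := fun z => (abs_sub _ _).trans (by linarith [hM z])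
  refine ⟨integrable_sum_eval_pow D (hu.sub_const a) hb N 2, ?_⟩
  rw [integral_sum_eval_sq D (hu.sub_const a) hb (by simp [integral_sub hI, ← ha])]
  refine mul_le_mul_of_nonneg_left ?_ (by positivity)
  have : ∀ z, (u z - a) ^ 2 = (u z ^ 2 - 2 * a * u z) + a ^ 2 := fun z => by ring
  simp_rw [this]
  have hI3 : Integrable (fun z => u z ^ 2 - 2 * a * u z) D := hI2.sub (hI.const_mul _)
  rw [integral_add hI3 (integrable_const _),
    integral_sub hI2 (hI.const_mul _), integral_const_mul, ← ha]
  simp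
  nlinarith [sq_nonneg a]

/-- A class of losses that deviate from a common `[0, 1]`-valued loss by at most `1` in total:
the sample size needed is independent of the size of the class. -/
theorem samplesSuffice_of_sum_abs_sub_le {B : Type*} [Fintype B] [Nonempty B] {g : A → Z → ℝ}
    {h : B → A} (hm : ∀ b, Measurable (g (h b))) (h0 : ∀ b z, 0 ≤ g (h b) z)
    {f : Z → ℝ} (hf : Measurable f) (hf1 : ∀ z, |f z| ≤ 1)
    (hgf : ∀ z, ∑ b, |g (h b) z - f z| ≤ 1)
    {ε δ : ℝ} (hε : 0 < ε) (hδ : 0 < δ) {N : ℕ} (hNδ : 8 / (δ * ε ^ 2) ≤ N) :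
    SamplesSuffice g (range h) ε δ N := by
  intro D hD
  have hNR : (0 : ℝ) < N := lt_of_lt_of_le (by positivity) hNδ
  rw [← ofReal_measureReal]
  refine ENNReal.ofReal_le_ofReal ?_
  set μ := Measure.pi fun _ : Fin N => D with hμ
  set u : B → Z → ℝ := fun b z => g (h b) z - f z with hu
  have hum : ∀ b, Measurable (u b) := fun b => (hm b).sub hf
  have hu1 : ∀ b z, |u b z| ≤ 1 := fun b z =>
    (Finset.single_le_sum (f := fun b => |u b z|) (fun _ _ => abs_nonneg _)
      (Finset.mem_univ b)).trans (hgf z)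
  have hIf : Integrable f D := by simpa using integrable_bounded_pow D hf hf1 1
  have hIu : ∀ b, Integrable (u b) D := fun b => by
    simpa using integrable_bounded_pow D (hum b) (hu1 b) 1
  set V : (Fin N → Z) → ℝ := fun s => (∑ n, (f (s n) - ∫ z, f z ∂D)) ^ 2 with hV
  set W : B → (Fin N → Z) → ℝ := fun b s => (∑ n, (u b (s n) - ∫ z, u b z ∂D)) ^ 2 with hW
  obtain ⟨hVI, hVle⟩ := integral_sum_eval_sub_sq_le D hf hf1 N
  have hWI := fun b => (integral_sum_eval_sub_sq_le D (hum b) (hu1 b) N).1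
  have hWle := fun b => (integral_sum_eval_sub_sq_le D (hum b) (hu1 b) N).2
  have hQI : Integrable (fun s => V s + ∑ b, W b s) μ :=
    hVI.add (integrable_finsetSum _ fun b _ => hWI b)
  -- Since `u b z ^ 2 ≤ |u b z|`, the second moments of all `u b` together sum to at most 1. One
  -- Markov inequality then covers every `b`, with no cost in the size of the class.
  have hQ : ∫ s, (V s + ∑ b, W b s) ∂μ ≤ 2 * N := by
    rw [integral_add hVI (integrable_finsetSum _ fun b _ => hWI b),
      integral_finsetSum _ fun b _ => hWI b]
    have a1 : ∫ z, f z ^ 2 ∂D ≤ 1 := by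
      have := integral_mono (integrable_bounded_pow D hf hf1 2) (integrable_const (1 : ℝ))
        (fun z => (sq_le_one_iff_abs_le_one _).2 (hf1 z))
      simpa using this
    have a2 : ∑ b, ∫ z, u b z ^ 2 ∂D ≤ 1 := by
      rw [← integral_finsetSum _ fun b _ => integrable_bounded_pow D (hum b) (hu1 b) 2]
      have := integral_mono
        (integrable_finsetSum _ fun b _ => integrable_bounded_pow D (hum b) (hu1 b) 2)
        (integrable_const (1 : ℝ)) (fun z => (Finset.sum_le_sum fun b _ => (by
          rw [← sq_abs, sq]
          exact mul_le_of_le_one_left (abs_nonneg _) (hu1 b z) :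
          u b z ^ 2 ≤ |u b z|)).trans (hgf z))
      simpa using this
    have a3 : ∑ b, ∫ s, W b s ∂μ ≤ N * ∑ b, ∫ z, u b z ^ 2 ∂D := by
      rw [Finset.mul_sum]
      exact Finset.sum_le_sum fun b _ => hWle b
    have a4 : ∫ s, V s ∂μ ≤ N * ∫ z, f z ^ 2 ∂D := hVle
    nlinarith
  have hmarkov := mul_meas_ge_le_integral_of_nonneg (μ := μ)
    (f := fun s => V s + ∑ b, W b s)
    (Filter.Eventually.of_forall fun s =>
      add_nonneg (sq_nonneg _) (Finset.sum_nonneg fun b _ => sq_nonneg _)) hQI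
    ((N * ε / 2) ^ 2)
  have hsub : {s : Fin N → Z | ¬ |statOptValue g (range h) D - empOptValue g (range h) s| ≤ ε} ⊆
      {s | (N * ε / 2) ^ 2 ≤ V s + ∑ b, W b s} := by
    intro s hs
    obtain ⟨b, hb⟩ := exists_deviation_of_not_abs_sub_le h0 hs
    simp only [mem_ofPred_eq]
    have e1 : ∑ n, g (h b) (s n) - N * ∫ z, g (h b) z ∂D =
        (∑ n, (f (s n) - ∫ z, f z ∂D)) + ∑ n, (u b (s n) - ∫ z, u b z ∂D) := by
      have : ∀ z, g (h b) z = f z + u b z := fun z => by simp [hu]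
      simp_rw [this]
      rw [integral_add hIf (hIu b)]
      simp [Finset.sum_sub_distrib, Finset.sum_add_distrib]
      ring
    have e2 : N * ((∫ z, g (h b) z ∂D) - (1 / (N : ℝ)) * ∑ n, g (h b) (s n)) =
        -((∑ n, (f (s n) - ∫ z, f z ∂D)) + ∑ n, (u b (s n) - ∫ z, u b z ∂D)) := by
      rw [← e1]; field_simp; ring
    have e3 : N * ε < |(∑ n, (f (s n) - ∫ z, f z ∂D)) + ∑ n, (u b (s n) - ∫ z, u b z ∂D)| := by
      rw [← abs_neg, ← e2, abs_mul, abs_of_pos hNR]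
      exact mul_lt_mul_of_pos_left hb hNR
    have hWb : W b s ≤ ∑ b, W b s :=
      Finset.single_le_sum (f := fun b => W b s) (fun _ _ => sq_nonneg _) (Finset.mem_univ b)
    have hV0 : 0 ≤ V s := sq_nonneg _
    have hW0 : 0 ≤ W b s := sq_nonneg _
    have e4 := e3.trans_le (abs_add_le _ _)
    have hpos : 0 ≤ N * ε / 2 := by positivity
    -- A deviation above `N * ε` puts at least half of it in the common part or in the part specific
    -- to `b`.
    rcases le_or_gt (N * ε / 2) |∑ n, (f (s n) - ∫ z, f z ∂D)| with hc | hc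
    · have := pow_le_pow_left₀ hpos hc 2
      rw [sq_abs] at this
      linarith
    · have := pow_le_pow_left₀ hpos
        (show N * ε / 2 ≤ |∑ n, (u b (s n) - ∫ z, u b z ∂D)| by linarith) 2
      rw [sq_abs] at this
      linarith
  refine (measureReal_mono hsub).trans ?_
  -- The constant 8 comes from `2 * N ≤ (N * ε / 2) ^ 2 * δ`.
  rw [div_le_iff₀ (by positivity)] at hNδ
  have h3 : (N * ε / 2) ^ 2 * μ.real {s | (N * ε / 2) ^ 2 ≤ V s + ∑ b, W b s} ≤
      (N * ε / 2) ^ 2 * δ := by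
    refine (hmarkov.trans hQ).trans ?_
    nlinarith
  exact le_of_mul_le_mul_left h3 (by positivity)

end UpperBounds

/-! ### Insufficient sample sizes. -/

section LowerBounds

variable {Z : Type*} [MeasurableSpace Z] [MeasurableSingletonClass Z]

/-- The uniform distribution on finitely many points. -/
theorem exists_uniform_measure {κ : Type*} [Fintype κ] [Nonempty κ] (φ : κ → Z) :
    ∃ D : Measure Z, IsProbabilityMeasure D ∧
      (∀ F : Z → ℝ, ∫ z, F z ∂D = 1 / Fintype.card κ * ∑ p, F (φ p)) ∧
      ∀ᵐ z ∂D, z ∈ range φ := by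
  refine ⟨(Fintype.card κ : ENNReal)⁻¹ • ∑ p, Measure.dirac (φ p), ⟨?_⟩, fun F => ?_, ?_⟩
  · simp [ENNReal.inv_mul_cancel]
  · rw [integral_smul_measure, integral_finsetSum_measure fun p _ => integrable_dirac (by simp)]
    simp
  · refine Measure.ae_smul_measure ?_ _
    rw [ae_iff]
    simp only [Measure.coe_finsetSum, Finset.sum_apply, Finset.sum_eq_zero_iff]
    intro p _
    change Measure.dirac (φ p) (range φ)ᶜ = 0
    rw [Measure.dirac_apply' _ ((finite_range φ).measurableSet.compl)]
    simp

/-- The coin at the pair `i`, read off at a point of `ι × Bool`. -/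
def pairSign {ι : Type*} [DecidableEq ι] (i : ι) (p : ι × Bool) : ℝ :=
  if p.1 = i then (if p.2 then 1 else -1) else 0

/-- The two signs cancel in odd powers and add up to 2 in even ones: under the uniform law the odd
moments vanish and the positive even ones are `1 / card ι`. -/
theorem sum_pairSign_pow {ι : Type*} [Fintype ι] [DecidableEq ι] (i : ι) {k : ℕ} (hk : k ≠ 0) :
    ∑ p, pairSign i p ^ k = 1 + (-1) ^ k := by
  rw [Fintype.sum_prod_type, Finset.sum_eq_single i]
  · simp [pairSign]
  · intro j _ hj
    simp [pairSign, hj, hk]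
  · simp

variable {A : Type*}

/-- If, for samples drawn from the uniform distribution on `φ`, the optimal values differ by the
sum of the absolute imbalances of the pairs, then a sample size of order `card ι / ε ^ 2` does
not suffice. -/
theorem not_samplesSuffice_of_sum_abs_sum_pairSign_le {ι : Type*} [Fintype ι] [Nonempty ι]
    [DecidableEq ι] {φ : ι × Bool → Z} (hφ : Function.Injective φ) {g : A → Z → ℝ} {H : Set A}
    (hstat : ⨅ h : H, 1 / (Fintype.card (ι × Bool) : ℝ) * ∑ p, g h (φ p) = 1 / 2) {N : ℕ}
    (hgap : ∀ s : Fin N → ι × Bool, ∑ i, |∑ n, pairSign i (s n)| ≤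
      2 * N * |1 / 2 - empOptValue g H (φ ∘ s)|)
    {ε δ : ℝ} (hε : 0 < ε) (hδ : δ < 1 / 16) (hN : Fintype.card ι ≤ N)
    (hNε : N ≤ Fintype.card ι / (64 * ε ^ 2)) : ¬ SamplesSuffice g H ε δ N := by
  classical
  intro hsuff
  obtain ⟨D, hD, hint, hae⟩ := exists_uniform_measure φ
  have hcard : (0 : ℝ) < Fintype.card ι := by exact_mod_cast Fintype.card_pos
  have hNpos : (0 : ℝ) < N := hcard.trans_le (by exact_mod_cast hN)
  set f : ι → Z → ℝ := fun i z =>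
    if z = φ (i, true) then 1 else if z = φ (i, false) then -1 else 0 with hf
  have hfφ : ∀ i p, f i (φ p) = pairSign i p := by
    rintro i ⟨j, b⟩
    simp only [hf, hφ.eq_iff, pairSign, Prod.mk.injEq]
    cases b <;> simp
  have hmom : ∀ i k, k ≠ 0 → ∫ z, f i z ^ k ∂D = 1 / (2 * Fintype.card ι) * (1 + (-1) ^ k) := by
    intro i k hk
    rw [hint]
    simp only [hfφ, sum_pairSign_pow i hk, Fintype.card_prod, Fintype.card_bool]
    push_cast
    rw [mul_comm (2 : ℝ)]
  have hprob := le_measure_sum_abs_sum_eval D (f := f)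
    (fun i => Measurable.ite (measurableSet_singleton _) measurable_const
      (Measurable.ite (measurableSet_singleton _) measurable_const measurable_const))
    (fun i z => by simp only [hf]; split_ifs <;> simp)
    (fun i => by simpa using hmom i 1 one_ne_zero)
    (fun i => by rw [hmom i 2 two_ne_zero]; field_simp; norm_num)
    (fun i => by rw [hmom i 3 three_ne_zero]; norm_num)
    (fun i => by rw [hmom i 4 four_ne_zero]; field_simp; norm_num) hN
  have hS := hsuff D hD
  have hstat' : statOptValue g H D = 1 / 2 := by
    rw [← hstat]
    exact iInf_congr fun h => hint _
  have hle : (Measure.pi fun _ : Fin N => D)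
      {s | √(Fintype.card ι * N) / 4 < ∑ i, |∑ n, f i (s n)|} ≤ ENNReal.ofReal δ := by
    refine le_trans (measure_mono_ae ?_) hS
    -- The gap is assumed only for samples in the range of `φ`, which almost every sample is.
    have hall : ∀ᵐ s ∂(Measure.pi fun _ : Fin N => D), ∀ n, s n ∈ range φ :=
      ae_all_iff.2 fun n => Measure.tendsto_eval_ae_ae.eventually hae
    filter_upwards [hall] with s hs hsT
    choose t ht using hs
    have hst : s = φ ∘ t := (funext ht).symm
    have h1 := hgap t
    have h2 : √(Fintype.card ι * N) / 4 < ∑ i, |∑ n, f i (s n)| := hsT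
    change ¬ |statOptValue g H D - empOptValue g H s| ≤ ε
    rw [hst, hstat', not_le]
    simp only [hst, Function.comp_apply, hfφ] at h2
    have h3 : 8 * N * ε ≤ √(Fintype.card ι * N) := by
      refine Real.le_sqrt_of_sq_le ?_
      rw [le_div_iff₀ (by positivity)] at hNε
      nlinarith
    have h4 : 2 * N * ε < 2 * N * |1 / 2 - empOptValue g H (φ ∘ t)| := by linarith
    exact lt_of_mul_lt_mul_left h4 (by positivity)
  -- `δ` may be negative here, and `ENNReal.ofReal` truncates it at 0.
  have h5 : (Measure.pi fun _ : Fin N => D).real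
      {s | √(Fintype.card ι * N) / 4 < ∑ i, |∑ n, f i (s n)|} ≤ max δ 0 := by
    refine ENNReal.toReal_le_of_le_ofReal (le_max_right _ _) (hle.trans ?_)
    exact ENNReal.ofReal_le_ofReal (le_max_left _ _)
  have h6 : max δ 0 < 1 / 16 := max_lt hδ (by norm_num)
  linarith

/-- A class all of whose losses are a fair coin needs order `1 / ε ^ 2` samples. -/
theorem not_samplesSuffice_of_coin {φ : Bool → Z} (hφ : Function.Injective φ) {g : A → Z → ℝ}
    {H : Set A} (hH : H.Nonempty) (hg : ∀ h ∈ H, ∀ j, g h (φ j) = if j then 1 else 0) {N : ℕ}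
    {ε δ : ℝ} (hε : 0 < ε) (hδ : δ < 1 / 16) (hN : 1 ≤ N) (hNε : N ≤ 1 / (64 * ε ^ 2)) :
    ¬ SamplesSuffice g H ε δ N := by
  have hne : Nonempty H := hH.to_subtype
  have hNpos : (0 : ℝ) < N := by exact_mod_cast hN
  refine not_samplesSuffice_of_sum_abs_sum_pairSign_le (ι := Unit) (φ := fun p => φ p.2)
    (fun p q h => Prod.ext rfl (hφ h)) ?_ ?_ hε hδ (by simpa using hN) (by simpa using hNε)
  · have : ∀ h : H, 1 / (Fintype.card (Unit × Bool) : ℝ) * ∑ p : Unit × Bool, g h (φ p.2)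
        = 1 / 2 := by
      intro h
      rw [Fintype.sum_prod_type]
      simp [hg h h.2]
    simp_rw [this]
    exact ciInf_const
  · intro s
    have : empOptValue g H ((fun p : Unit × Bool => φ p.2) ∘ s) =
        1 / (N : ℝ) * ∑ n, (1 + pairSign () (s n)) / 2 := by
      unfold empOptValue
      have : ∀ h : H, 1 / (N : ℝ) * ∑ n, g h (((fun p : Unit × Bool => φ p.2) ∘ s) n) =
          1 / (N : ℝ) * ∑ n, (1 + pairSign () (s n)) / 2 := by
        intro h
        congr 1
        refine Finset.sum_congr rfl fun n _ => ?_
        simp only [Function.comp_apply, hg h h.2, pairSign, if_true]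
        split_ifs <;> norm_num
      simp_rw [this]
      exact ciInf_const
    rw [this, ← Finset.sum_div, Finset.sum_add_distrib]
    simp only [Finset.univ_unique, PUnit.default_eq_unit, Finset.sum_singleton,
      Finset.sum_const, Finset.card_univ, Fintype.card_fin, nsmul_eq_mul, mul_one]
    rw [show (1 / 2 : ℝ) - 1 / N * ((N + ∑ n, pairSign () (s n)) / 2) =
      -((∑ n, pairSign () (s n)) / (2 * N)) by field_simp; ring, abs_neg, abs_div,
      abs_of_pos (by positivity : (0 : ℝ) < 2 * N)]
    rw [mul_div_cancel₀ _ (by positivity)]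

/-- A class that realises, on `card ι` pairs of points, every choice of the erroneous member of
each pair needs order `card ι / ε ^ 2` samples. -/
theorem not_samplesSuffice_of_pairs {ι : Type*} [Fintype ι] [Nonempty ι] [DecidableEq ι]
    {φ : ι × Bool → Z} (hφ : Function.Injective φ) {g : A → Z → ℝ} {h : (ι → Bool) → A}
    (hg0 : ∀ b z, 0 ≤ g (h b) z)
    (hg : ∀ b p, g (h b) (φ p) = if b p.1 = p.2 then 1 else 0) {N : ℕ}
    {ε δ : ℝ} (hε : 0 < ε) (hδ : δ < 1 / 16) (hN : Fintype.card ι ≤ N)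
    (hNε : N ≤ Fintype.card ι / (64 * ε ^ 2)) :
    ¬ SamplesSuffice g (range h) ε δ N := by
  have hcard : (0 : ℝ) < Fintype.card ι := by exact_mod_cast Fintype.card_pos
  have hNpos : (0 : ℝ) < N := hcard.trans_le (by exact_mod_cast hN)
  refine not_samplesSuffice_of_sum_abs_sum_pairSign_le hφ ?_ ?_ hε hδ hN hNε
  · have : ∀ a : range h, 1 / (Fintype.card (ι × Bool) : ℝ) * ∑ p, g a (φ p) = 1 / 2 := by
      rintro ⟨_, b, rfl⟩
      simp only [hg, Fintype.sum_prod_type, Finset.sum_ite_eq, Finset.mem_univ, if_true,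
        Finset.sum_const, Finset.card_univ, Fintype.card_prod, Fintype.card_bool]
      push_cast
      field_simp
      norm_num
    simp_rw [this]
    exact ciInf_const
  · intro s
    set X : ι → ℝ := fun i => ∑ n, pairSign i (s n) with hX
    -- The empirical minimiser: `X i ≤ 0` means that `(i, true)` is no more frequent than `(i,
    -- false)`, so the error is put there.
    set b : ι → Bool := fun i => decide (X i ≤ 0) with hb
    have hbdd : BddBelow (range fun a : range h => 1 / (N : ℝ) * ∑ n, g a ((φ ∘ s) n)) := by
      refine ⟨0, ?_⟩
      rintro _ ⟨⟨_, b, rfl⟩, rfl⟩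
      exact mul_nonneg (by positivity) (Finset.sum_nonneg fun n _ => hg0 b _)
    have hle : empOptValue g (range h) (φ ∘ s) ≤ 1 / (N : ℝ) * ∑ n, g (h b) (φ (s n)) :=
      ciInf_le hbdd ⟨h b, b, rfl⟩
    have hloss : ∀ p, g (h b) (φ p) =
        (1 + ∑ i, (if b i then 1 else -1) * pairSign i p) / 2 := by
      rintro ⟨i, j⟩
      rw [Finset.sum_eq_single i]
      · rw [hg]
        cases hbi : b i <;> cases j <;> simp [pairSign]
      · intro k _ hk
        simp [pairSign, Ne.symm hk]
      · simp
    have hsum : ∑ n, g (h b) (φ (s n)) = (N - ∑ i, |X i|) / 2 := by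
      simp_rw [hloss]
      rw [← Finset.sum_div, Finset.sum_add_distrib, Finset.sum_comm]
      congr 1
      have : ∀ i, ∑ n, (if b i then (1 : ℝ) else -1) * pairSign i (s n) = -|X i| := by
        intro i
        rw [← Finset.mul_sum]
        change _ * X i = _
        by_cases hi : X i ≤ 0
        · simp [hb, hi, abs_of_nonpos hi]
        · simp [hb, hi, abs_of_pos (not_le.1 hi)]
      rw [Finset.sum_congr rfl fun i _ => this i]
      simp [sub_eq_add_neg]
    rw [hsum] at hle
    have h1 : 1 / (N : ℝ) * ((N - ∑ i, |X i|) / 2) = 1 / 2 - (∑ i, |X i|) / (2 * N) := by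
      field_simp
    have h2 : (∑ i, |X i|) / (2 * N) ≤ |1 / 2 - empOptValue g (range h) (φ ∘ s)| :=
      le_trans (by linarith) (le_abs_self _)
    rw [div_le_iff₀ (by positivity)] at h2
    linarith

end LowerBounds

/-! ### Robust and nominal losses as indicators. -/

section RobustLoss

theorem zeroOneLoss_nonneg {Y : Type*} [DecidableEq Y] (y' y : Y) : 0 ≤ zeroOneLoss y' y := by
  unfold zeroOneLoss; split_ifs <;> norm_num

theorem zeroOneLoss_le_one {Y : Type*} [DecidableEq Y] (y' y : Y) : zeroOneLoss y' y ≤ 1 := by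
  unfold zeroOneLoss; split_ifs <;> norm_num

variable {X Y : Type*} [Add X] [MeasurableSpace X] [DecidableEq Y] {Δ : Set X}

/-- The probabilistically robust loss is the indicator of the event that more than a proportion
`ρ` of the perturbations is misclassified. -/
theorem robustLoss_eq (r : Measure Δ) [IsProbabilityMeasure r] {ρ : ℝ} (hρ0 : 0 ≤ ρ) (hρ1 : ρ < 1)
    (h : X → Y) (z : X × Y) :
    robustLoss r ρ h z = if r.real {δ : Δ | h (z.1 + (δ : X)) ≠ z.2} ≤ ρ then 0 else 1 := by
  have hiff : ∀ s : Set Δ, r s ≤ ENNReal.ofReal ρ ↔ r.real s ≤ ρ := fun s =>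
    ENNReal.le_ofReal_iff_toReal_le (measure_ne_top r s) hρ0
  have hneg : ∀ u < 0, {δ : Δ | u < zeroOneLoss (h (z.1 + (δ : X))) z.2} = univ := fun u hu =>
    eq_univ_of_forall fun δ => hu.trans_le (zeroOneLoss_nonneg _ _)
  have hmid : ∀ u, 0 ≤ u → u < 1 → {δ : Δ | u < zeroOneLoss (h (z.1 + (δ : X))) z.2} =
      {δ : Δ | h (z.1 + (δ : X)) ≠ z.2} := fun u hu hu1 => by
    ext δ
    simp only [zeroOneLoss, mem_ofPred_eq]
    split_ifs with hne
    · exact iff_of_true hu1 hne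
    · exact iff_of_false (not_lt.2 hu) hne
  have hbig : ∀ u, 1 ≤ u → {δ : Δ | u < zeroOneLoss (h (z.1 + (δ : X))) z.2} = ∅ := fun u hu =>
    eq_empty_of_forall_notMem fun δ hδ => absurd hδ (not_lt.2 ((zeroOneLoss_le_one _ _).trans hu))
  unfold robustLoss rhoEssSup
  simp only [hiff]
  split_ifs with hB
  -- Negative levels are exceeded everywhere, hence excluded by `ρ < 1`; otherwise the set would be
  -- unbounded below.
  · have : {u : ℝ | r.real {δ : Δ | u < zeroOneLoss (h (z.1 + (δ : X))) z.2} ≤ ρ} = Ici 0 := by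
      ext u
      simp only [mem_ofPred_eq, mem_Ici]
      rcases lt_or_ge u 0 with hu | hu
      · rw [hneg u hu, probReal_univ]
        exact iff_of_false (not_le.2 hρ1) (not_le.2 hu)
      · refine iff_of_true ?_ hu
        rcases lt_or_ge u 1 with hu1 | hu1
        · rwa [hmid u hu hu1]
        · rw [hbig u hu1]
          simpa using hρ0
    rw [this, csInf_Ici]
  · have : {u : ℝ | r.real {δ : Δ | u < zeroOneLoss (h (z.1 + (δ : X))) z.2} ≤ ρ} = Ici 1 := by
      ext u
      simp only [mem_ofPred_eq, mem_Ici]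
      rcases lt_or_ge u 1 with hu1 | hu1
      · refine iff_of_false ?_ (not_le.2 hu1)
        rcases lt_or_ge u 0 with hu | hu
        · rw [hneg u hu, probReal_univ]
          exact not_le.2 hρ1
        · rwa [hmid u hu hu1]
      · rw [hbig u hu1]
        exact iff_of_true (by simpa using hρ0) hu1
    rw [this, csInf_Ici]

theorem robustLoss_nonneg (r : Measure Δ) [IsProbabilityMeasure r] {ρ : ℝ} (hρ0 : 0 ≤ ρ)
    (hρ1 : ρ < 1) (h : X → Y) (z : X × Y) : 0 ≤ robustLoss r ρ h z := by
  rw [robustLoss_eq r hρ0 hρ1]; split_ifs <;> norm_num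

theorem robustLoss_le_one (r : Measure Δ) [IsProbabilityMeasure r] {ρ : ℝ} (hρ0 : 0 ≤ ρ)
    (hρ1 : ρ < 1) (h : X → Y) (z : X × Y) : robustLoss r ρ h z ≤ 1 := by
  rw [robustLoss_eq r hρ0 hρ1]; split_ifs <;> norm_num

variable [MeasurableSpace Y] [MeasurableSingletonClass Y] [Countable Y]

/-- The mass of the misclassified section depends measurably on the instance, as in Tonelli's
theorem, and the loss thresholds it. -/
theorem measurable_robustLoss [MeasurableAdd₂ X] (r : Measure Δ) [IsProbabilityMeasure r] {ρ : ℝ}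
    (hρ0 : 0 ≤ ρ) (hρ1 : ρ < 1) {h : X → Y} (hh : Measurable h) :
    Measurable (robustLoss r ρ h) := by
  have hset : MeasurableSet {p : (X × Y) × Δ | h (p.1.1 + (p.2 : X)) ≠ p.1.2} :=
    (measurableSet_eq_fun (by fun_prop) (by fun_prop)).compl
  have hm : Measurable fun z : X × Y => r.real {δ : Δ | h (z.1 + (δ : X)) ≠ z.2} :=
    (measurable_measure_prodMk_left hset).ennreal_toReal
  rw [show robustLoss r ρ h = fun z => _ from funext fun z => robustLoss_eq r hρ0 hρ1 h z]
  exact Measurable.ite (measurableSet_le hm measurable_const) measurable_const measurable_const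

end RobustLoss

theorem measurable_nominalLoss {X Y : Type*} [MeasurableSpace X] [DecidableEq Y]
    [MeasurableSpace Y] [MeasurableSingletonClass Y] [Countable Y] {h : X → Y} (hh : Measurable h) :
    Measurable (nominalLoss h) := by
  unfold nominalLoss zeroOneLoss
  exact Measurable.ite
    (measurableSet_eq_fun (hh.comp measurable_fst) measurable_snd).compl
    measurable_const measurable_const

/-- Matching upper and lower bounds for the sample complexity. -/
theorem exists_isSampleComplexity {A Z : Type*} [MeasurableSpace Z] {g : A → Z → ℝ} {H : Set A}
    {ε δ a B : ℝ} (hB : 0 ≤ B) (hup : ∀ n : ℕ, B ≤ n → SamplesSuffice g H ε δ n)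
    (hlow : ¬ SamplesSuffice g H ε δ ⌊a⌋₊) :
    ∃ N : ℕ, IsSampleComplexity g H ε δ N ∧ a ≤ N ∧ N ≤ B + 1 := by
  classical
  have hex : ∃ N₀ : ℕ, ∀ n, N₀ ≤ n → SamplesSuffice g H ε δ n :=
    ⟨⌈B⌉₊, fun n hn => hup n (Nat.ceil_le.1 hn)⟩
  have hleast : IsSampleComplexity g H ε δ (Nat.find hex) :=
    ⟨Nat.find_spec hex, fun n hn => Nat.find_min' hex hn⟩
  refine ⟨Nat.find hex, hleast, ?_, ?_⟩
  -- Failure at the single size `⌊a⌋₊` is enough, since all sizes beyond the sample complexity must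
  -- suffice.
  · have h1 : ⌊a⌋₊ < Nat.find hex := by
      by_contra hc
      exact hlow (hleast.1 _ (not_lt.1 hc))
    have h2 : ((⌊a⌋₊ + 1 : ℕ) : ℝ) ≤ Nat.find hex := by exact_mod_cast h1
    push_cast at h2
    linarith [Nat.lt_floor_add_one a]
  · have h1 : Nat.find hex ≤ ⌈B⌉₊ := hleast.2 fun n hn => hup n (Nat.ceil_le.1 hn)
    have h2 : ((Nat.find hex : ℕ) : ℝ) ≤ ⌈B⌉₊ := by exact_mod_cast h1
    exact h2.trans (Nat.ceil_lt_add_one hB).le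

/-! ### The hard class. -/

/-- A class of `2 ^ m` classifiers that is hard to learn against adversarial perturbations only:
all classifiers have the same probabilistically robust losses, their nominal losses differ from
a common one at disjoint sets of instances, and their adversarial losses realise every choice of
the erroneous member of each of `m` pairs of instances. -/
theorem exists_classifiers {E : Type*} [NormedAddCommGroup E] [NormedSpace ℝ E]
    [ProperSpace E] [MeasurableSpace E] [BorelSpace E] {Δ : Set E} (hΔ : Bornology.IsBounded Δ)
    (r : Measure Δ) [IsProbabilityMeasure r] [NullSingletonClass r] [r.IsOpenPosMeasure]
    (k m : ℕ) {ρ₀ : ℝ} (hρ₀ : 0 < ρ₀) :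
    ∃ (h : (Fin m → Bool) → E → Fin (k + 2)) (φ : Fin m × Bool → E) (e : E),
      (∀ b, Measurable (h b)) ∧
      (∀ ρ, ρ₀ ≤ ρ → ρ ≤ 1 - ρ₀ → ∀ b z, robustLoss r ρ (h b) z = if z.2 = 0 then 0 else 1) ∧
      (∀ x b b', h b x ≠ 0 → h b' x ≠ 0 → b = b') ∧
      (∀ b, h b e = 0) ∧ Function.Injective φ ∧
      (∀ b p, robustLoss r 0 (h b) (φ p, 0) = if b p.1 = p.2 then 1 else 0) := by
  classical
  -- The index `none` is a spare base point, whose perturbations avoid every spot in use. The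
  -- tolerance keeps the total mass of `m` spots strictly below `ρ₀`, also when `m = 0`.
  obtain ⟨x, S, hx, hSm, hSd, hSpos, hSfar, hSlt⟩ := exists_separated_spots hΔ r
    (Option (Fin m × Bool)) (Fin m → Bool) (t := ENNReal.ofReal (ρ₀ / (m + 1)))
    (ENNReal.ofReal_pos.2 (by positivity))
  set T : (Fin m → Bool) → Set E := fun b => ⋃ i, S (some (i, b i)) b with hT
  set h : (Fin m → Bool) → E → Fin (k + 2) := fun b z => if z ∈ T b then 1 else 0 with hh
  have hTm : ∀ b, MeasurableSet (T b) := fun b => MeasurableSet.iUnion fun i => hSm _ _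
  have h0 : ∀ b z, h b z ≠ 0 ↔ z ∈ T b := fun b z => by simp [hh]
  have hTlt : ∀ b z, r.real {δ : Δ | z + (δ : E) ∈ T b} < ρ₀ := fun b z => by
    have hsub : {δ : Δ | z + (δ : E) ∈ T b} =
        ⋃ i, {δ : Δ | z + (δ : E) ∈ S (some (i, b i)) b} := by
      ext δ; simp [hT]
    rw [hsub]
    calc r.real (⋃ i, {δ : Δ | z + (δ : E) ∈ S (some (i, b i)) b})
        ≤ ∑ i, r.real {δ : Δ | z + (δ : E) ∈ S (some (i, b i)) b} :=
          measureReal_iUnion_fintype_le _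
      _ ≤ ∑ _i : Fin m, ρ₀ / (m + 1) := Finset.sum_le_sum fun i _ =>
          ENNReal.toReal_le_of_le_ofReal (by positivity) (hSlt _ _ _).le
      _ = ρ₀ * (m / (m + 1)) := by simp; ring
      _ < ρ₀ := by
          have : (m : ℝ) / (m + 1) < 1 := by rw [div_lt_one (by positivity)]; linarith
          nlinarith
  have : Infinite Δ := infinite_of_nullSingletonClass r
  obtain ⟨δ₀⟩ : Nonempty Δ := inferInstance
  refine ⟨h, fun p => x (some p), x none + δ₀,
    fun b => Measurable.ite (hTm b) measurable_const measurable_const, ?_, ?_, ?_,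
    fun p q hpq => Option.some_injective _ (hx hpq), ?_⟩
  · rintro ρ hρ hρ' b ⟨z, y⟩
    rw [robustLoss_eq r (hρ₀.le.trans hρ) (by linarith)]
    by_cases hy : y = 0
    · subst hy
      simp only [h0]
      rw [if_pos ((hTlt b z).le.trans hρ), if_pos trivial]
    -- For a nonzero label everything off the spots is misclassified: mass above `1 - ρ₀ ≥ ρ`.
    · have hsub : {δ : Δ | z + (δ : E) ∈ T b}ᶜ ⊆ {δ : Δ | h b (z + (δ : E)) ≠ y} := by
        intro δ hδ
        have : h b (z + (δ : E)) = 0 := by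
          by_contra hc
          exact hδ ((h0 _ _).1 hc)
        simp only [mem_ofPred_eq, this]
        exact Ne.symm hy
      have hmeas : MeasurableSet {δ : Δ | z + (δ : E) ∈ T b} :=
        (measurable_const.add measurable_subtype_coe) (hTm b)
      have h1 := measureReal_mono (μ := r) hsub
      rw [probReal_compl_eq_one_sub hmeas] at h1
      rw [if_neg (by simp only; linarith [hTlt b z]), if_neg hy]
  · intro z b b' hb hb'
    rw [h0, hT, mem_iUnion] at hb hb'
    obtain ⟨i, hi⟩ := hb
    obtain ⟨i', hi'⟩ := hb'
    by_contra hne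
    exact hSd _ _ _ _ (fun he => hne (Prod.ext_iff.1 he).2) z hi hi'
  · intro b
    by_contra hc
    rw [← ne_eq, h0, hT, mem_iUnion] at hc
    obtain ⟨i, hi⟩ := hc
    exact hSfar none _ b (by simp) δ₀ δ₀.2 hi
  · rintro b ⟨i, j⟩
    rw [robustLoss_eq r le_rfl one_pos]
    simp only [h0]
    by_cases hij : b i = j
    · subst hij
      rw [if_pos rfl, if_neg]
      rw [not_le]
      refine ENNReal.toReal_pos (ne_of_gt (lt_of_lt_of_le (hSpos (some (i, b i)) b)
        (measure_mono fun δ hδ => ?_))) (measure_ne_top _ _)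
      exact mem_iUnion.2 ⟨i, hδ⟩
    · rw [if_neg hij, if_pos]
      have : {δ : Δ | x (some (i, j)) + (δ : E) ∈ T b} = ∅ := by
        refine eq_empty_of_forall_notMem fun δ hδ => ?_
        obtain ⟨i', hi'⟩ := mem_iUnion.1 hδ
        refine hSfar (some (i, j)) (some (i', b i')) b ?_ δ δ.2 hi'
        rintro he
        simp only [Option.some.injEq, Prod.mk.injEq] at he
        obtain ⟨rfl, rfl⟩ := he
        exact hij rfl
      rw [this]
      simp

/-! ### Constants and conclusion. -/

/-- Uses `2 ≤ exp 1` and `1 / δ ≤ exp (1 / δ)`. The latter is crude, but the dependence of `C` on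
`δ` is free. -/
theorem two_pow_mul_exp_le {m : ℕ} (hm : 1 ≤ m) {δ t : ℝ} (hδ : 0 < δ) (hδ1 : δ ≤ 1)
    (ht : 4 * m / δ ≤ t) : (2 : ℝ) ^ m * (2 * Real.exp (-t)) ≤ δ := by
  have hm' : (1 : ℝ) ≤ m := by exact_mod_cast hm
  have h1 : (2 : ℝ) ≤ Real.exp 1 := by linarith [Real.add_one_le_exp (1 : ℝ)]
  have h2 : (2 : ℝ) ^ (m + 1) ≤ Real.exp (m + 1) := by
    calc (2 : ℝ) ^ (m + 1) ≤ Real.exp 1 ^ (m + 1) := pow_le_pow_left₀ (by norm_num) h1 _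
      _ = Real.exp (m + 1) := by rw [← Real.exp_nat_mul]; push_cast; ring_nf
  have h3 : 1 / δ ≤ Real.exp (1 / δ) := by linarith [Real.add_one_le_exp (1 / δ)]
  have h4 : (m : ℝ) + 1 + 1 / δ ≤ t := by
    refine le_trans ?_ ht
    rw [le_div_iff₀ hδ]
    have : (m + 1 + 1 / δ) * δ = m * δ + δ + 1 := by field_simp
    rw [this]
    nlinarith
  have h5 : (2 : ℝ) ^ (m + 1) * (1 / δ) ≤ Real.exp t := by
    calc (2 : ℝ) ^ (m + 1) * (1 / δ) ≤ Real.exp (m + 1) * Real.exp (1 / δ) := by gcongr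
      _ = Real.exp (m + 1 + 1 / δ) := by rw [← Real.exp_add]
      _ ≤ _ := Real.exp_le_exp.2 h4
  rw [Real.exp_neg]
  have h6 : (2 : ℝ) ^ m * (2 * (Real.exp t)⁻¹) = 2 ^ (m + 1) / Real.exp t := by
    rw [pow_succ]; ring
  rw [h6, div_le_iff₀ (Real.exp_pos _)]
  calc (2 : ℝ) ^ (m + 1) = δ * (2 ^ (m + 1) * (1 / δ)) := by field_simp
    _ ≤ _ := by gcongr

theorem proposition2 :
    ∃ ε₀ : ℝ, 0 < ε₀ ∧ ∃ δ₀ : ℝ, 0 < δ₀ ∧ ∃ c : ℝ, 0 < c ∧ ∃ C : ℝ → ℝ,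
    ∀ (d K : ℕ), 2 ≤ K →
    ∀ (Δ : Set (EuclideanSpace ℝ (Fin d))), Bornology.IsBounded Δ →
    ∀ (r : Measure Δ) [IsProbabilityMeasure r] [NullSingletonClass r] [r.IsOpenPosMeasure],
    ∀ ρ₀ : ℝ, 0 < ρ₀ → ρ₀ < 1 / 2 →
    ∃ H : Set (EuclideanSpace ℝ (Fin d) → Fin K),
      H.Nonempty ∧ (∀ h ∈ H, Measurable h) ∧
      ∀ δ : ℝ, 0 < δ → δ < δ₀ → ∀ ε : ℝ, 0 < ε → ε < ε₀ →
        (∃ N : ℕ, IsSampleComplexity (robustLoss r 0) H ε δ N ∧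
          c * (Real.logb 2 (1 / ρ₀) / ε ^ 2) ≤ N ∧
          N ≤ C δ * (Real.logb 2 (1 / ρ₀) / ε ^ 2)) ∧
        (∀ ρ : ℝ, ρ₀ ≤ ρ → ρ ≤ 1 - ρ₀ →
          ∃ N : ℕ, IsSampleComplexity (robustLoss r ρ) H ε δ N ∧
            c * (1 / ε ^ 2) ≤ N ∧ N ≤ C δ * (1 / ε ^ 2)) ∧
        (∃ N : ℕ, IsSampleComplexity nominalLoss H ε δ N ∧
          c * (1 / ε ^ 2) ≤ N ∧ N ≤ C δ * (1 / ε ^ 2)) := by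
  -- `ε < 1 / 8` gives `64 * ε ^ 2 ≤ 1`, so the failing sample size is at least the number of pairs,
  -- as anti-concentration requires; 1/16 is the probability found there.
  refine ⟨1 / 8, by norm_num, 1 / 16, by norm_num, 1 / 64, by norm_num, fun δ => 16 / δ, ?_⟩
  intro d K hK Δ hΔ r _ _ _ ρ₀ hρ₀ hρ₀'
  obtain ⟨k, rfl⟩ := Nat.exists_eq_add_of_le' hK
  set l := Real.logb 2 (1 / ρ₀) with hl
  have hl1 : 1 < l := by
    rw [hl, Real.lt_logb_iff_rpow_lt (by norm_num) (by positivity), Real.rpow_one,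
      lt_div_iff₀ hρ₀]
    linarith
  -- `ρ₀ < 1 / 2` gives `l > 1`, so rounding up costs at most a factor 2.
  set m := ⌈l⌉₊ with hm
  have hlm : l ≤ m := Nat.le_ceil l
  have hml : (m : ℝ) ≤ 2 * l := by linarith [(Nat.ceil_lt_add_one (by linarith : 0 ≤ l))]
  have hm1 : 1 ≤ m := by
    have : (1 : ℝ) < m := by linarith
    exact_mod_cast this.le
  have hm1R : (1 : ℝ) ≤ m := by exact_mod_cast hm1
  have : Nonempty (Fin m) := ⟨⟨0, hm1⟩⟩
  obtain ⟨h, φ, e, hmeas, hrob, hdisj, he, hφ, hadv⟩ := exists_classifiers hΔ r k m hρ₀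
  refine ⟨range h, range_nonempty h, by rintro _ ⟨b, rfl⟩; exact hmeas b, ?_⟩
  intro δ hδ hδ' ε hε hε'
  have hε2 : 0 < ε ^ 2 := by positivity
  have hε64 : 64 * ε ^ 2 ≤ 1 := by nlinarith
  have hfloor : ∀ q : ℝ, 0 ≤ q → q ≤ q / (64 * ε ^ 2) := fun q hq => by
    rw [le_div_iff₀ (by positivity)]
    nlinarith
  have hδε : 1 ≤ 1 / (δ * ε ^ 2) := by
    rw [le_div_iff₀ (by positivity)]
    nlinarith
  have hcoin : Function.Injective
      (fun j : Bool => ((e, if j then 1 else 0) : EuclideanSpace ℝ (Fin d) × Fin (k + 2))) := by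
    intro i j
    cases i <;> cases j <;> simp
  have hbase : Measurable
      (fun z : EuclideanSpace ℝ (Fin d) × Fin (k + 2) => if z.2 = 0 then (0 : ℝ) else 1) :=
    Measurable.ite (measurable_snd (measurableSet_singleton 0)) measurable_const measurable_const
  have hbase1 : ∀ z : EuclideanSpace ℝ (Fin d) × Fin (k + 2),
      |if z.2 = 0 then (0 : ℝ) else 1| ≤ 1 := fun z => by split_ifs <;> simp
  have hcoinlow : ∀ g : (EuclideanSpace ℝ (Fin d) → Fin (k + 2)) →
      EuclideanSpace ℝ (Fin d) × Fin (k + 2) → ℝ,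
      (∀ b, ∀ j : Bool, g (h b) (e, if j then 1 else 0) = if j then 1 else 0) →
      ¬ SamplesSuffice g (range h) ε δ ⌊1 / (64 * ε ^ 2)⌋₊ := by
    intro g hg
    refine not_samplesSuffice_of_coin hcoin (range_nonempty h) ?_ hε hδ' ?_
      (Nat.floor_le (by positivity))
    · rintro _ ⟨b, rfl⟩ j
      exact hg b j
    · exact Nat.le_floor (by simpa using hfloor 1 zero_le_one)
  have hconv : ∀ q : ℝ, 1 / 64 * (q / ε ^ 2) = q / (64 * ε ^ 2) := fun q => by
    field_simp
  have hbound : 8 / (δ * ε ^ 2) + 1 ≤ 16 / δ * (1 / ε ^ 2) := by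
    rw [show 16 / δ * (1 / ε ^ 2) = 16 * (1 / (δ * ε ^ 2)) by field_simp,
      show 8 / (δ * ε ^ 2) = 8 * (1 / (δ * ε ^ 2)) by ring]
    linarith
  refine ⟨?_, ?_, ?_⟩
  · obtain ⟨N, hN, hNl, hNu⟩ := exists_isSampleComplexity (g := robustLoss r 0) (H := range h)
      (ε := ε) (δ := δ) (a := m / (64 * ε ^ 2)) (B := 2 * m / (δ * ε ^ 2)) (by positivity)
      (fun n hn => by
        have hnpos : (0 : ℝ) < n := lt_of_lt_of_le (by positivity) hn
        refine samplesSuffice_of_hoeffding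
          (fun b => measurable_robustLoss r le_rfl one_pos (hmeas b))
          (fun b z => robustLoss_nonneg r le_rfl one_pos _ _)
          (fun b z => robustLoss_le_one r le_rfl one_pos _ _) hε.le (by exact_mod_cast hnpos) ?_
        simp only [Fintype.card_pi, Fintype.card_bool, Finset.prod_const, Finset.card_univ,
          Fintype.card_fin]
        push_cast
        refine two_pow_mul_exp_le hm1 hδ (by linarith) ?_
        rw [div_le_iff₀ (by positivity)] at hn ⊢
        linarith)
      (not_samplesSuffice_of_pairs (φ := fun p => (φ p, 0))
        (fun p q hpq => hφ (Prod.ext_iff.1 hpq).1)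
        (fun b z => robustLoss_nonneg r le_rfl one_pos _ _) hadv hε hδ'
        (by rw [Fintype.card_fin]; exact Nat.le_floor (hfloor m (by positivity)))
        (by rw [Fintype.card_fin]; exact Nat.floor_le (by positivity)))
    refine ⟨N, hN, ?_, ?_⟩
    · rw [hconv]
      refine le_trans ?_ hNl
      gcongr
    · refine hNu.trans ?_
      rw [show 16 / δ * (l / ε ^ 2) = 16 * l * (1 / (δ * ε ^ 2)) by field_simp,
        show 2 * m / (δ * ε ^ 2) = 2 * m * (1 / (δ * ε ^ 2)) by ring]
      nlinarith
  · intro ρ hρ hρ'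
    have hρ0 : 0 ≤ ρ := hρ₀.le.trans hρ
    have hρ1 : ρ < 1 := by linarith
    obtain ⟨N, hN, hNl, hNu⟩ := exists_isSampleComplexity (g := robustLoss r ρ) (H := range h)
      (ε := ε) (δ := δ) (a := 1 / (64 * ε ^ 2)) (B := 8 / (δ * ε ^ 2)) (by positivity)
      (fun n hn => samplesSuffice_of_sum_abs_sub_le
        (fun b => measurable_robustLoss r hρ0 hρ1 (hmeas b))
        (fun b z => robustLoss_nonneg r hρ0 hρ1 _ _) hbase hbase1
        (fun z => by simp [hrob ρ hρ hρ']) hε hδ hn)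
      (hcoinlow _ fun b j => by rw [hrob ρ hρ hρ']; cases j <;> simp)
    exact ⟨N, hN, by rwa [hconv], hNu.trans hbound⟩
  · obtain ⟨N, hN, hNl, hNu⟩ := exists_isSampleComplexity
      (g := nominalLoss (X := EuclideanSpace ℝ (Fin d)) (Y := Fin (k + 2))) (H := range h)
      (ε := ε) (δ := δ) (a := 1 / (64 * ε ^ 2)) (B := 8 / (δ * ε ^ 2)) (by positivity)
      (fun n hn => samplesSuffice_of_sum_abs_sub_le
        (fun b => measurable_nominalLoss (hmeas b))
        (fun b z => zeroOneLoss_nonneg _ _) hbase hbase1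
        -- At most one classifier is nonzero at `z.1`, so at most one term of the sum survives.
        (fun z => by
          have hzero : ∀ b, h b z.1 = 0 →
              |nominalLoss (h b) z - if z.2 = 0 then 0 else 1| = 0 := fun b hb => by
            simp [nominalLoss, zeroOneLoss, hb, eq_comm]
          have hone : ∀ b, |nominalLoss (h b) z - if z.2 = 0 then 0 else 1| ≤ 1 := fun b => by
            unfold nominalLoss zeroOneLoss
            split_ifs <;> simp
          by_cases hall : ∀ b, h b z.1 = 0
          · rw [Finset.sum_eq_zero fun b _ => hzero b (hall b)]
            exact zero_le_one
          · push Not at hall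
            obtain ⟨b, hb⟩ := hall
            rw [Finset.sum_eq_single b
              (fun b' _ hb' => hzero b' (by
                by_contra hc
                exact hb' (hdisj _ _ _ hc hb)))
              (fun hb' => absurd (Finset.mem_univ b) hb')]
            exact hone b) hε hδ hn)
      (hcoinlow _ fun b j => by cases j <;> simp [nominalLoss, zeroOneLoss, he])
    exact ⟨N, hN, by rwa [hconv], hNu.trans hbound⟩
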